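/- Let $R$ be a (left) Noetherian ring and let $V$ be a finitely generated FI-module over $R$. Here an FI-module over $R$ is a functor from the category FI of finite sets and injections to the category of (left) $R$-modules; write $V_n = V(\{1,\dots,n\})$, with the $S_n$-action induced by functoriality. $V$ is finitely generated if there is a finite set of elements of $\coprod_{i\ge 0} V_i$ that is contained in no proper sub-FI-module of $V$. Then there exists an integer $N \ge 0$ such that for every $n \ge 0$ there is an isomorphism of $S_n$-representations over $R$ $$\varinjlim_{S} V(S) \;\cong\; V_n,$$ where the colimit is taken over the poset, ordered by inclusion, of the subsets $S \subseteq \{1,\dots,n\}$ with $|S| \le N$, and $\sigma \in S_n$ acts on the colimit through the maps $V(S) \to V(\sigma(S))$ induced by the bijections $\sigma|_S : S \to \sigma(S)$. The isomorphism can be taken to be the natural map, induced by the inclusions $S \hookrightarrow \{1,\dots,n\}$. -/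

import Mathlib

open CategoryTheory CategoryTheory.Limits

universe u v

/-- An object of the category FI: a finite set. -/
structure FI : Type 1 where
  /-- The underlying set. -/
  carrier : Type
  [finite : Finite carrier]

namespace FI

attribute [instance] FI.finite

/-- The morphisms of FI are the injections. -/
instance : Category FI where
  Hom X Y := X.carrier ↪ Y.carrier
  id X := Function.Embedding.refl X.carrier
  comp f g := Function.Embedding.trans f g

/-- The set `{1, …, n}`, as an object of FI. -/
abbrev std (n : ℕ) : FI := ⟨Fin n⟩

/-- A permutation, as a morphism of FI. -/
def ofPerm {n : ℕ} (σ : Equiv.Perm (Fin n)) : std n ⟶ std n := σ.toEmbedding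

/-- A finite subset of `{1, …, n}`, as an object of FI. -/
abbrev ofFinset {n : ℕ} (S : Finset (Fin n)) : FI := ⟨{a : Fin n // a ∈ S}⟩

/-- The inclusion of a subset `S` into `{1, …, n}`. -/
def incl {n : ℕ} (S : Finset (Fin n)) : ofFinset S ⟶ std n := Function.Embedding.subtype _

/-- The injection `S → T` obtained by restricting a permutation `σ` with `σ(S) ⊆ T`. -/
def restrict {n : ℕ} (σ : Equiv.Perm (Fin n)) {S T : Finset (Fin n)}
    (h : ∀ a ∈ S, σ a ∈ T) : ofFinset S ⟶ ofFinset T :=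
  (⟨fun a => ⟨σ a.1, h a.1 a.2⟩, fun _ _ hab =>
    Subtype.ext (σ.injective (congrArg Subtype.val hab))⟩ :
    {a : Fin n // a ∈ S} ↪ {a : Fin n // a ∈ T})

/-- The inclusion `S → T` of finite subsets of `{1, …, n}`. -/
def inclusion {n : ℕ} {S T : Finset (Fin n)} (h : S ⊆ T) : ofFinset S ⟶ ofFinset T :=
  Subtype.impEmbedding _ _ fun _ ha => h ha

end FI

/-- The poset of subsets `S ⊆ {1, …, n}` with `|S| ≤ N`, ordered by inclusion. -/
abbrev SmallSubset (n N : ℕ) : Type := {S : Finset (Fin n) // S.card ≤ N}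

namespace SmallSubset

/-- The tautological functor from the poset of subsets with at most `N` elements to FI. -/
def toFI (n N : ℕ) : SmallSubset n N ⥤ FI where
  obj S := FI.ofFinset S.1
  map f := FI.inclusion (leOfHom f)

/-- The image `σ(S)` of a subset with at most `N` elements. -/
def image {n N : ℕ} (σ : Equiv.Perm (Fin n)) (S : SmallSubset n N) : SmallSubset n N :=
  ⟨S.1.map σ.toEmbedding, by rw [Finset.card_map]; exact S.2⟩

theorem mem_image {n N : ℕ} (σ : Equiv.Perm (Fin n)) (S : SmallSubset n N) :
    ∀ a ∈ S.1, σ a ∈ (image σ S).1 :=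
  fun _ ha => Finset.mem_map_of_mem σ.toEmbedding ha

theorem image_le {n N : ℕ} {σ : Equiv.Perm (Fin n)} {S T : SmallSubset n N}
    (h : ∀ a ∈ S.1, σ a ∈ T.1) : image σ S ≤ T := by
  intro b hb
  obtain ⟨a, ha, rfl⟩ := Finset.mem_map.1 hb
  exact h a ha

end SmallSubset

/-- An FI-module over `R`: a functor from FI to the category of (left) `R`-modules. -/
abbrev FIModule (R : Type u) [Ring R] := FI ⥤ ModuleCat.{v} R

namespace FIModule

variable {R : Type u} [Ring R]

/-- A sub-FI-module of `V`: submodules of the modules `V(X)`, preserved by the maps of `V`. -/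
structure Sub (V : FIModule.{u, v} R) where
  /-- The submodule of `V(X)`. -/
  obj (X : FI) : Submodule R (V.obj X)
  map_mem {X Y : FI} (f : X ⟶ Y) (x : V.obj X) : x ∈ obj X → V.map f x ∈ obj Y

/-- `V` is finitely generated if there is a finite set of elements of `∐ i, V_i` that is
contained in no proper sub-FI-module of `V`. -/
def FinitelyGenerated (V : FIModule.{u, v} R) : Prop :=
  ∃ s : Set (Σ i : ℕ, V.obj (FI.std i)), s.Finite ∧
    ∀ W : Sub V, (∀ x ∈ s, x.2 ∈ W.obj (FI.std x.1)) → ∀ X : FI, W.obj X = ⊤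

/-- The action of the symmetric group `S_n` on `V_n`. -/
def perm (V : FIModule.{u, v} R) (n : ℕ) :
    Equiv.Perm (Fin n) →* Module.End R (V.obj (FI.std n)) where
  toFun σ := (V.map (FI.ofPerm σ)).hom
  map_one' := congrArg ModuleCat.Hom.hom (V.map_id (FI.std n))
  map_mul' σ τ := congrArg ModuleCat.Hom.hom (V.map_comp (FI.ofPerm τ) (FI.ofPerm σ))

/-- The diagram `S ↦ V(S)` on the poset of subsets `S ⊆ {1, …, n}` with `|S| ≤ N`. -/
abbrev diagram (V : FIModule.{u, v} R) (n N : ℕ) : SmallSubset n N ⥤ ModuleCat.{v} R :=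
  SmallSubset.toFI n N ⋙ V

/-- The colimit of the modules `V(S)` over the subsets `S ⊆ {1, …, n}` with `|S| ≤ N`. -/
noncomputable abbrev smallColimit (V : FIModule.{u, v} R) (n N : ℕ) : ModuleCat.{v} R :=
  colimit (V.diagram n N)

/-- The structure map `V(S) → colim V`. -/
noncomputable abbrev toColimit (V : FIModule.{u, v} R) {n N : ℕ} (S : SmallSubset n N) :
    V.obj (FI.ofFinset S.1) ⟶ V.smallColimit n N :=
  colimit.ι (V.diagram n N) S

theorem map_restrict_toColimit (V : FIModule.{u, v} R) {n N : ℕ} (σ : Equiv.Perm (Fin n))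
    {S T : SmallSubset n N} (h : ∀ a ∈ S.1, σ a ∈ T.1) :
    V.map (FI.restrict σ h) ≫ V.toColimit T =
      V.map (FI.restrict σ (SmallSubset.mem_image σ S)) ≫ V.toColimit (SmallSubset.image σ S) := by
  have hw : V.map (FI.inclusion (SmallSubset.image_le h)) ≫ V.toColimit T =
      V.toColimit (SmallSubset.image σ S) :=
    colimit.w (V.diagram n N) (homOfLE (SmallSubset.image_le h))
  rw [← hw, ← Category.assoc, ← V.map_comp]
  rfl

/-- The endomorphism of `colim V(S)` induced by a permutation `σ`: on `V(S)` it is the map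
`V(S) → V(σ(S))` induced by the bijection `σ : S → σ(S)`, followed by the structure map. -/
noncomputable def permColimitHom (V : FIModule.{u, v} R) (n N : ℕ) (σ : Equiv.Perm (Fin n)) :
    V.smallColimit n N ⟶ V.smallColimit n N :=
  colimit.desc (V.diagram n N)
    { pt := V.smallColimit n N
      ι :=
        { app := fun S =>
            V.map (FI.restrict σ (SmallSubset.mem_image σ S)) ≫
              V.toColimit (SmallSubset.image σ S)
          naturality := fun S T f => by
            have hST : ∀ a ∈ S.1, σ a ∈ (SmallSubset.image σ T).1 := fun a ha =>
              SmallSubset.mem_image σ T a (leOfHom f ha)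
            have h := V.map_restrict_toColimit σ hST
            have hr : FI.restrict σ hST =
                FI.inclusion (leOfHom f) ≫ FI.restrict σ (SmallSubset.mem_image σ T) := rfl
            rw [hr, V.map_comp, Category.assoc] at h
            exact h.trans (Category.comp_id _).symm } }

theorem toColimit_permColimitHom (V : FIModule.{u, v} R) {n N : ℕ} (σ : Equiv.Perm (Fin n))
    (S : SmallSubset n N) :
    V.toColimit S ≫ V.permColimitHom n N σ =
      V.map (FI.restrict σ (SmallSubset.mem_image σ S)) ≫
        V.toColimit (SmallSubset.image σ S) :=
  colimit.ι_desc _ S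

/-- The action of `S_n` on the colimit of the modules `V(S)`. -/
noncomputable def permColimit (V : FIModule.{u, v} R) (n N : ℕ) :
    Equiv.Perm (Fin n) →* Module.End R (V.smallColimit n N) where
  toFun σ := (V.permColimitHom n N σ).hom
  map_one' := by
    have h : V.permColimitHom n N 1 = 𝟙 _ := by
      refine colimit.hom_ext fun S => ?_
      change V.toColimit S ≫ V.permColimitHom n N 1 = V.toColimit S ≫ 𝟙 _
      rw [V.toColimit_permColimitHom, ← V.map_restrict_toColimit 1 (S := S) (T := S)
        (fun a ha => ha), Category.comp_id]
      exact (congrArg (· ≫ V.toColimit S) (V.map_id _)).trans (Category.id_comp _)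
    exact congrArg ModuleCat.Hom.hom h
  map_mul' σ τ := by
    have h : V.permColimitHom n N (σ * τ) =
        V.permColimitHom n N τ ≫ V.permColimitHom n N σ := by
      refine colimit.hom_ext fun S => ?_
      change V.toColimit S ≫ V.permColimitHom n N (σ * τ) =
        V.toColimit S ≫ V.permColimitHom n N τ ≫ V.permColimitHom n N σ
      rw [V.toColimit_permColimitHom, ← Category.assoc, V.toColimit_permColimitHom,
        Category.assoc, V.toColimit_permColimitHom, ← Category.assoc, ← V.map_comp,
        ← V.map_restrict_toColimit (σ * τ) (S := S)
          (T := SmallSubset.image σ (SmallSubset.image τ S))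
          (fun a ha => SmallSubset.mem_image σ _ _ (SmallSubset.mem_image τ S a ha))]
      rfl
    exact congrArg ModuleCat.Hom.hom h

end FIModule

/-!
Finitely many elements generating `V` define a surjection from a free FI-module `P` onto `V`. If
the generators have degree at most `N` and the relations, the kernel of `P → V`, are generated in
degree at most `N`, then `P_n → V_n` lifts to a surjection `P_n → colim V(S)` that kills all
relations, so the natural map `colim V(S) → V_n` is bijective.

That the relations are generated in bounded degree is proved by a Gröbner basis argument. Only maps
induced by order embeddings are used, since these preserve a lexicographic order on the standard
basis of `P` and hence leading terms. By Higman's lemma, divisibility of basis elements along order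
embeddings is a well-quasi-order; as `R` is left Noetherian, so is its refinement that also requires
equal ideals of leading coefficients. Hence finitely many basis elements account for all leading
terms of relations, and division by them reduces every relation to zero.
-/

section WellQuasiOrder

variable {α : Type*} {r : α → α → Prop}

theorem exists_finset_forall_exists_rel_of_wellQuasiOrdered (hr : WellQuasiOrdered r) :
    ∃ s : Finset α, ∀ x, ∃ y ∈ s, r y x := by
  by_contra! hs
  obtain ⟨f, -, hf⟩ := exists_seq_of_forall_finset_exists (fun _ => True) (fun y x => ¬r y x)
    fun s _ => (hs s).imp fun _ hx => ⟨trivial, hx⟩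
  obtain ⟨i, j, hij, hrel⟩ := hr f
  exact hf i j hij hrel

theorem wellQuasiOrdered_and_eq_of_monotone {β : Type*} [PartialOrder β] [WellFoundedGT β]
    [IsPreorder α r] (hr : WellQuasiOrdered r) {φ : α → β} (hφ : ∀ a b, r a b → φ a ≤ φ b) :
    WellQuasiOrdered fun a b => r a b ∧ φ a = φ b := by
  intro u
  obtain ⟨g, hg⟩ := hr.exists_monotone_subseq u
  obtain ⟨n, hn⟩ := WellFoundedGT.monotone_chain_condition
    (⟨fun i => φ (u (g i)), fun i j hij => hφ _ _ (hg i j hij)⟩ : ℕ →o β)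
  exact ⟨g n, g (n + 1), g.strictMono n.lt_succ_self, hg _ _ n.le_succ, hn _ n.le_succ⟩

theorem wellQuasiOrdered_sublist (α : Type*) [Finite α] :
    WellQuasiOrdered (List.Sublist : List α → List α → Prop) := by
  intro f
  have higman := Set.PartiallyWellOrderedOn.partiallyWellOrderedOn_sublistForall₂
    (s := (Set.univ : Set α)) (· = ·) fun f => Finite.wellQuasiOrdered _ f
  obtain ⟨i, j, hij, h⟩ := higman fun n => ⟨f n, fun _ _ => Set.mem_univ _⟩
  obtain ⟨l, hl, hlj⟩ := List.sublistForall₂_iff.1 h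
  rw [List.forall₂_eq_eq_eq] at hl
  subst hl
  exact ⟨i, j, hij, hlj⟩

end WellQuasiOrder

section LeadingIdeal

variable {R : Type*} {B C : Type*}

section Preorder

variable [Semiring R] [Preorder B]

/-- The left ideal of leading coefficients, at the basis element `b`, of a submodule `M` of the
free module on an ordered basis: the coefficients at `b` of the elements of `M` that
involve only basis elements `≤ b`. The coefficient may vanish, so `0` is included. -/
noncomputable def leadingIdeal (M : Submodule R (B →₀ R)) (b : B) : Ideal R :=
  (M ⊓ Finsupp.supported R R (Set.Iic b)).map (Finsupp.lapply b)

theorem leadingIdeal_mono {M M' : Submodule R (B →₀ R)} (h : M ≤ M') (b : B) :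
    leadingIdeal M b ≤ leadingIdeal M' b :=
  Submodule.map_mono (inf_le_inf_right _ h)

end Preorder

variable [LinearOrder B]

theorem leadingIdeal_le_leadingIdeal_map [Semiring R] [Preorder C] {g : B → C} (hg : StrictMono g)
    (M : Submodule R (B →₀ R)) (b : B) :
    leadingIdeal M b ≤ leadingIdeal (M.map (Finsupp.lmapDomain R R g)) (g b) := by
  classical
  rintro _ ⟨p, ⟨hpM, hpb⟩, rfl⟩
  refine ⟨Finsupp.mapDomain g p, ⟨Submodule.mem_map_of_mem hpM, fun c hc => ?_⟩,
    Finsupp.mapDomain_apply hg.injective p b⟩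
  obtain ⟨d, hd, rfl⟩ := Finset.mem_image.1 (Finsupp.mapDomain_support hc)
  exact hg.monotone (hpb hd)

theorem exists_mem_support_mem_supported_Iic [Semiring R] {p : B →₀ R} (hp : p ≠ 0) :
    ∃ c ∈ p.support, p ∈ Finsupp.supported R R (Set.Iic c) :=
  have hne := Finsupp.support_nonempty_iff.2 hp
  ⟨_, p.support.max'_mem hne, fun d hd => p.support.le_max' d hd⟩

/-- Division algorithm: an element of `M'` with the same leading term is subtracted until nothing
is left. -/
theorem le_of_leadingIdeal_le [Ring R] [WellFoundedLT B] {M M' : Submodule R (B →₀ R)}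
    (hM' : M' ≤ M) (h : ∀ b, leadingIdeal M b ≤ leadingIdeal M' b) : M ≤ M' := by
  have mem_of_supported (b : B) : ∀ p ∈ M, p ∈ Finsupp.supported R R (Set.Iic b) → p ∈ M' := by
    induction b using WellFoundedLT.induction with
    | _ b ih =>
      intro p hpM hpb
      obtain ⟨q, ⟨hqM', hqb⟩, hq⟩ := h b ⟨p, ⟨hpM, hpb⟩, rfl⟩
      refine (Submodule.sub_mem_iff_left M' hqM').1 ?_
      rcases eq_or_ne (p - q) 0 with h0 | h0
      · exact h0 ▸ M'.zero_mem
      obtain ⟨c, hc, hsupp⟩ := exists_mem_support_mem_supported_Iic h0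
      have hcb : c ≤ b := Submodule.sub_mem _ hpb hqb hc
      have hcb' : c ≠ b := by
        rintro rfl
        exact Finsupp.mem_support_iff.1 hc (sub_eq_zero.2 hq.symm)
      exact ih c (hcb.lt_of_ne hcb') _ (M.sub_mem hpM (hM' hqM')) hsupp
  intro p hp
  rcases eq_or_ne p 0 with rfl | h0
  · exact M'.zero_mem
  · obtain ⟨c, -, hsupp⟩ := exists_mem_support_mem_supported_Iic h0
    exact mem_of_supported c p hp hsupp

end LeadingIdeal

/-- The standard basis, at a set `A`, of the free FI-module with one generator in degree `m i` for
each `i`: an element is a generator together with an injection of `{1, …, m i}` into `A`. -/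
structure FreeBasis {ι : Type*} (m : ι → ℕ) (A : Type*) where
  /-- The generator. -/
  index : ι
  /-- The injection along which the generator is pushed forward. -/
  emb : Fin (m index) ↪ A

namespace FreeBasis

variable {ι : Type*} {m : ι → ℕ} {A B : Type*}

/-- The map of standard bases induced by an injection. -/
def map (f : A ↪ B) (x : FreeBasis m A) : FreeBasis m B := ⟨x.index, x.emb.trans f⟩

/-- A basis element as an element of a lexicographic order: first the generator is compared, then
the values of the injection. -/
def toLexSigma (x : FreeBasis m A) : Σₗ i : ι, Lex (Fin (m i) → A) :=
  toLex ⟨x.index, toLex x.emb⟩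

theorem toLexSigma_injective :
    Function.Injective (toLexSigma : FreeBasis m A → _) := by
  rintro ⟨i, x⟩ ⟨j, y⟩ h
  obtain rfl : i = j := congrArg Sigma.fst h
  have hxy : (x : Fin (m i) → A) = y := eq_of_heq (Sigma.mk.inj h).2
  exact congrArg (mk i) (DFunLike.coe_injective hxy)

instance [Finite ι] [Finite A] : Finite (FreeBasis m A) :=
  have : Finite (Σₗ i : ι, Lex (Fin (m i) → A)) :=
    inferInstanceAs (Finite (Σ i : ι, Fin (m i) → A))
  Finite.of_injective toLexSigma toLexSigma_injective

noncomputable instance [LinearOrder ι] [LinearOrder A] : LinearOrder (FreeBasis m A) :=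
  LinearOrder.lift' toLexSigma toLexSigma_injective

theorem map_strictMono [LinearOrder ι] [LinearOrder A] [LinearOrder B] (f : A ↪o B) :
    StrictMono (map f.toEmbedding : FreeBasis m A → FreeBasis m B) := by
  rintro ⟨i, x⟩ ⟨j, y⟩ (h : toLexSigma ⟨i, x⟩ < toLexSigma ⟨j, y⟩)
  change toLexSigma (map f.toEmbedding ⟨i, x⟩) < toLexSigma (map f.toEmbedding ⟨j, y⟩)
  rw [Sigma.Lex.lt_def] at h ⊢
  rcases h with hij | ⟨hij, hxy⟩
  · exact Or.inl hij
  · obtain rfl : i = j := hij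
    obtain ⟨a, heq, hlt⟩ := hxy
    exact Or.inr ⟨rfl, a, fun b hb => congrArg f (heq b hb), f.strictMono hlt⟩

/-- The divisibility relation between basis elements, possibly at different ordered sets: `x`
divides `y` if some order embedding maps `x` to `y`. -/
def Divides [LE A] [LE B] (x : FreeBasis m A) (y : FreeBasis m B) : Prop :=
  ∃ f : A ↪o B, x.map f.toEmbedding = y

instance : IsPreorder (Σ n : ℕ, FreeBasis m (Fin n)) fun x y => x.2.Divides y.2 where
  refl _ := ⟨RelEmbedding.refl _, rfl⟩
  trans := by
    rintro x y z ⟨f, hf⟩ ⟨g, hg⟩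
    exact ⟨f.trans g, by rw [← hg, ← hf]; rfl⟩

/-- A basis element at `{1, …, n}`, encoded as a word of length `n`: the letter in position `b`
records the preimage of `b`, if there is one. -/
noncomputable def word {n : ℕ} (x : FreeBasis m (Fin n)) : List (Option (Σ i : ι, Fin (m i))) :=
  List.ofFn fun b => (Function.partialInv x.emb b).map (Sigma.mk x.index)

theorem length_word {n : ℕ} (x : FreeBasis m (Fin n)) : x.word.length = n :=
  List.length_ofFn

theorem get_word {n : ℕ} (x : FreeBasis m (Fin n)) (b : Fin x.word.length) :
    x.word.get b = (Function.partialInv x.emb (b.cast x.length_word)).map (Sigma.mk x.index) :=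
  List.get_ofFn _ b

theorem divides_of_word_sublist {n n' : ℕ} {x : FreeBasis m (Fin n)} {y : FreeBasis m (Fin n')}
    (hi : x.index = y.index) (h : x.word.Sublist y.word) : x.Divides y := by
  obtain ⟨i, x⟩ := x
  obtain ⟨j, y⟩ := y
  obtain rfl : i = j := hi
  obtain ⟨g, hg⟩ := List.sublist_iff_exists_fin_orderEmbedding_get_eq.1 h
  refine ⟨((Fin.castOrderIso (length_word _).symm).toOrderEmbedding.trans g).trans
    (Fin.castOrderIso (length_word _)).toOrderEmbedding,
    congrArg (mk i) (Function.Embedding.ext fun a => ?_)⟩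
  have hletter := hg (Fin.cast (length_word _).symm (x a))
  rw [get_word, get_word, Fin.cast_cast, Fin.cast_eq_self,
    Function.partialInv_left x.injective] at hletter
  have hpreimage := Option.map_injective (sigma_mk_injective (β := fun i => Fin (m i))) hletter
  exact ((y.injective.isPartialInv a _).1 hpreimage.symm).symm

theorem wellQuasiOrdered_divides [Finite ι] :
    WellQuasiOrdered fun x y : Σ n : ℕ, FreeBasis m (Fin n) => x.2.Divides y.2 := by
  intro s
  obtain ⟨a, b, hab, hindex, hword⟩ :=
    (Finite.wellQuasiOrdered (α := ι) (· = ·)).prod (wellQuasiOrdered_sublist _)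
      fun n => ((s n).2.index, (s n).2.word)
  exact ⟨a, b, hab, divides_of_word_sublist hindex hword⟩

/-- The map of the free FI-module induced by an injection. -/
noncomputable abbrev linearMap (R : Type*) [Semiring R] (f : A ↪ B) :
    (FreeBasis m A →₀ R) →ₗ[R] (FreeBasis m B →₀ R) :=
  Finsupp.lmapDomain R R (map f)

/-- A basis element at `X`, as a morphism of FI. -/
def hom {X : FI} (b : FreeBasis m X.carrier) : FI.std (m b.index) ⟶ X := b.emb

end FreeBasis

/-- A sub-OI-module of a free FI-module: submodules at the sets `{1, …, n}`, preserved by the maps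
induced by order embeddings. -/
structure OISub (R : Type*) [Ring R] {ι : Type*} (m : ι → ℕ) where
  /-- The submodule at `{1, …, n}`. -/
  obj (n : ℕ) : Submodule R (FreeBasis m (Fin n) →₀ R)
  map_le {a b : ℕ} (f : Fin a ↪o Fin b) :
    (obj a).map (FreeBasis.linearMap R f.toEmbedding) ≤ obj b

namespace OISub

variable {R : Type*} [Ring R] {ι : Type*} {m : ι → ℕ} (W : OISub R m)

/-- The part, at `{1, …, n}`, of the sub-OI-module generated by the elements of `W` of degree at
most `N`. -/
noncomputable def generatedLE (N n : ℕ) : Submodule R (FreeBasis m (Fin n) →₀ R) :=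
  ⨆ (k : ℕ) (_ : k ≤ N) (f : Fin k ↪o Fin n), (W.obj k).map (FreeBasis.linearMap R f.toEmbedding)

theorem map_le_generatedLE {N k n : ℕ} (hk : k ≤ N) (f : Fin k ↪o Fin n) :
    (W.obj k).map (FreeBasis.linearMap R f.toEmbedding) ≤ W.generatedLE N n :=
  le_iSup_of_le k (le_iSup_of_le hk (le_iSup_of_le f le_rfl))

theorem generatedLE_le (N n : ℕ) : W.generatedLE N n ≤ W.obj n :=
  iSup_le fun _ => iSup_le fun _ => iSup_le W.map_le

theorem generatedLE_mono {N N' : ℕ} (h : N ≤ N') (n : ℕ) :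
    W.generatedLE N n ≤ W.generatedLE N' n :=
  iSup_le fun _ => iSup_le fun hk => iSup_le (W.map_le_generatedLE (hk.trans h))

section LeadingIdeal

variable [LinearOrder ι]

theorem leadingIdeal_le_of_divides {a b : ℕ} {x : FreeBasis m (Fin a)} {y : FreeBasis m (Fin b)}
    (h : x.Divides y) : leadingIdeal (W.obj a) x ≤ leadingIdeal (W.obj b) y := by
  obtain ⟨f, rfl⟩ := h
  exact (leadingIdeal_le_leadingIdeal_map (FreeBasis.map_strictMono f) _ x).trans
    (leadingIdeal_mono (W.map_le f) _)

theorem exists_leadingIdeal_eq [Finite ι] [IsNoetherianRing R] :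
    ∃ N : ℕ, ∀ (n : ℕ) (x : FreeBasis m (Fin n)), ∃ k ≤ N, ∃ y : FreeBasis m (Fin k),
      y.Divides x ∧ leadingIdeal (W.obj k) y = leadingIdeal (W.obj n) x := by
  obtain ⟨s, hs⟩ := exists_finset_forall_exists_rel_of_wellQuasiOrdered <|
    wellQuasiOrdered_and_eq_of_monotone FreeBasis.wellQuasiOrdered_divides
      (φ := fun x : Σ n, FreeBasis m (Fin n) => leadingIdeal (W.obj x.1) x.2)
      fun _ _ => W.leadingIdeal_le_of_divides
  refine ⟨s.sup Sigma.fst, fun n x => ?_⟩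
  obtain ⟨y, hy, hdvd, heq⟩ := hs ⟨n, x⟩
  exact ⟨y.1, Finset.le_sup hy, y.2, hdvd, heq⟩

end LeadingIdeal

theorem exists_generatedLE_eq [Finite ι] [IsNoetherianRing R] :
    ∃ N : ℕ, ∀ n : ℕ, W.generatedLE N n = W.obj n := by
  let : LinearOrder ι := IsWellOrder.linearOrder WellOrderingRel
  obtain ⟨N, hN⟩ := W.exists_leadingIdeal_eq
  refine ⟨N, fun n => (W.generatedLE_le N n).antisymm <|
    le_of_leadingIdeal_le (W.generatedLE_le N n) fun x => ?_⟩
  obtain ⟨k, hk, y, ⟨f, rfl⟩, heq⟩ := hN n x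
  rw [← heq]
  exact (leadingIdeal_le_leadingIdeal_map (FreeBasis.map_strictMono f) _ y).trans
    (leadingIdeal_mono (W.map_le_generatedLE hk f) _)

end OISub

namespace FI

variable {X : FI} {n N : ℕ}

/-- The image of an injection `X → {1, …, n}` of a set with at most `N` elements. -/
noncomputable def image (f : X ⟶ std n) (hX : Nat.card X.carrier ≤ N) : SmallSubset n N :=
  ⟨(Set.finite_range f.toFun).toFinset, by
    rw [← Set.ncard_eq_toFinset_card]
    exact (Nat.card_range_of_injective f.injective).trans_le hX⟩

/-- An injection `X → {1, …, n}`, as a map onto its image. -/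
def toImage (f : X ⟶ std n) (hX : Nat.card X.carrier ≤ N) : X ⟶ ofFinset (image f hX).1 :=
  f.codRestrict _ fun a => (Set.Finite.mem_toFinset _).2 ⟨a, rfl⟩

theorem image_comp_incl_le {S : SmallSubset n N} (g : X ⟶ ofFinset S.1)
    (hX : Nat.card X.carrier ≤ N) : image (g ≫ incl S.1) hX ≤ S := by
  intro b hb
  obtain ⟨a, rfl⟩ := (Set.Finite.mem_toFinset _).1 hb
  exact (g.toFun a).2

end FI

namespace FIModule

variable {R : Type u} [Ring R] (V : FIModule.{u, v} R)

section SmallColimit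

variable {n N : ℕ}

/-- The natural map `V(X) → colim V(S)` attached to an injection `X → {1, …, n}` of a set with at
most `N` elements. -/
noncomputable def toColimitOfHom {X : FI} (f : X ⟶ FI.std n) (hX : Nat.card X.carrier ≤ N) :
    V.obj X ⟶ V.smallColimit n N :=
  V.map (FI.toImage f hX) ≫ V.toColimit (FI.image f hX)

theorem map_comp_toColimit {X : FI} {S : SmallSubset n N} (g : X ⟶ FI.ofFinset S.1)
    (hX : Nat.card X.carrier ≤ N) :
    V.map g ≫ V.toColimit S = V.toColimitOfHom (g ≫ FI.incl S.1) hX := by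
  have hle := FI.image_comp_incl_le g hX
  have hw : V.map (FI.inclusion hle) ≫ V.toColimit S = V.toColimit _ :=
    colimit.w (V.diagram n N) (homOfLE hle)
  rw [toColimitOfHom, ← hw, ← Category.assoc, ← V.map_comp]
  rfl

theorem map_comp_toColimitOfHom {X Y : FI} (g : X ⟶ Y) (f : Y ⟶ FI.std n)
    (hX : Nat.card X.carrier ≤ N) (hY : Nat.card Y.carrier ≤ N) :
    V.map g ≫ V.toColimitOfHom f hY = V.toColimitOfHom (g ≫ f) hX := by
  rw [toColimitOfHom, ← Category.assoc, ← V.map_comp, V.map_comp_toColimit _ hX]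
  rfl

theorem toColimitOfHom_incl (S : SmallSubset n N)
    (hS : Nat.card (FI.ofFinset S.1).carrier ≤ N) :
    V.toColimitOfHom (FI.incl S.1) hS = V.toColimit S := by
  rw [← Category.id_comp (FI.incl S.1), ← V.map_comp_toColimit, V.map_id, Category.id_comp]

theorem smallColimit_submodule_eq_top {W : Submodule R (V.smallColimit n N)}
    (h : ∀ (S : SmallSubset n N) (y : V.obj (FI.ofFinset S.1)), V.toColimit S y ∈ W) : W = ⊤ := by
  suffices hmk : ModuleCat.ofHom W.mkQ = 0 by
    rw [← Submodule.ker_mkQ W]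
    exact LinearMap.ker_eq_top.2 (congrArg ModuleCat.Hom.hom hmk)
  refine colimit.hom_ext fun S => ModuleCat.hom_ext (LinearMap.ext fun y => ?_)
  exact (Submodule.Quotient.mk_eq_zero W).2 (h S y)

variable (n N) in
/-- The natural map from the colimit to `V_n`. -/
noncomputable def fromColimit : V.smallColimit n N ⟶ V.obj (FI.std n) :=
  colimit.desc (V.diagram n N)
    { pt := V.obj (FI.std n)
      ι :=
        { app := fun S => V.map (FI.incl S.1)
          naturality := fun _ T f =>
            ((V.map_comp (FI.inclusion (leOfHom f)) (FI.incl T.1)).symm.trans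
              (Category.comp_id _).symm) } }

theorem toColimit_comp_fromColimit (S : SmallSubset n N) :
    V.toColimit S ≫ V.fromColimit n N = V.map (FI.incl S.1) :=
  colimit.ι_desc _ S

theorem fromColimit_toColimit (S : SmallSubset n N) (y : V.obj (FI.ofFinset S.1)) :
    V.fromColimit n N (V.toColimit S y) = V.map (FI.incl S.1) y :=
  ConcreteCategory.congr_hom (V.toColimit_comp_fromColimit S) y

theorem toColimitOfHom_comp_fromColimit {X : FI} (f : X ⟶ FI.std n)
    (hX : Nat.card X.carrier ≤ N) :
    V.toColimitOfHom f hX ≫ V.fromColimit n N = V.map f := by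
  rw [toColimitOfHom, Category.assoc, toColimit_comp_fromColimit, ← V.map_comp]
  rfl

theorem fromColimit_permColimit (σ : Equiv.Perm (Fin n)) (z : V.smallColimit n N) :
    V.fromColimit n N (V.permColimit n N σ z) = V.perm n σ (V.fromColimit n N z) := by
  suffices h : V.permColimitHom n N σ ≫ V.fromColimit n N =
      V.fromColimit n N ≫ V.map (FI.ofPerm σ) from ConcreteCategory.congr_hom h z
  refine colimit.hom_ext fun S => ?_
  change V.toColimit S ≫ _ = V.toColimit S ≫ _
  rw [← Category.assoc, V.toColimit_permColimitHom, Category.assoc, V.toColimit_comp_fromColimit,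
    ← Category.assoc, V.toColimit_comp_fromColimit, ← V.map_comp, ← V.map_comp]
  rfl

end SmallColimit

section Cover

variable {ι : Type*} {m : ι → ℕ} (x : ∀ i, V.obj (FI.std (m i)))

/-- The map to `V(X)` from the free FI-module on generators sent to the elements `x i`. -/
noncomputable def cover (X : FI) : (FreeBasis m X.carrier →₀ R) →ₗ[R] V.obj X :=
  Finsupp.linearCombination R fun b => V.map b.hom (x b.index)

theorem cover_single {X : FI} (b : FreeBasis m X.carrier) (r : R) :
    V.cover x X (Finsupp.single b r) = r • V.map b.hom (x b.index) :=
  Finsupp.linearCombination_single R r b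

theorem cover_linearMap {X Y : FI} (f : X ⟶ Y) (p : FreeBasis m X.carrier →₀ R) :
    V.cover x Y (FreeBasis.linearMap R f p) = V.map f (V.cover x X p) := by
  suffices h : V.cover x Y ∘ₗ FreeBasis.linearMap R f = (V.map f).hom ∘ₗ V.cover x X from
    LinearMap.congr_fun h p
  refine Finsupp.lhom_ext fun b r => ?_
  simp only [LinearMap.comp_apply, Finsupp.lmapDomain_apply, Finsupp.mapDomain_single,
    cover_single, map_smul]
  exact congrArg (r • ·) (ConcreteCategory.congr_hom (V.map_comp b.hom f) _)

/-- The images of the maps from the free FI-module form a sub-FI-module. -/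
noncomputable def coverRange : Sub V where
  obj X := LinearMap.range (V.cover x X)
  map_mem := by
    rintro X Y f _ ⟨p, rfl⟩
    exact ⟨_, V.cover_linearMap x f p⟩

theorem mem_coverRange (i : ι) : x i ∈ (V.coverRange x).obj (FI.std (m i)) := by
  refine ⟨Finsupp.single ⟨i, Function.Embedding.refl _⟩ 1, ?_⟩
  rw [cover_single, one_smul]
  exact ConcreteCategory.congr_hom (V.map_id _) _

theorem FinitelyGenerated.exists_cover_surjective {V : FIModule.{u, v} R}
    (hV : V.FinitelyGenerated) :
    ∃ (k : ℕ) (m : Fin k → ℕ) (x : ∀ i, V.obj (FI.std (m i))),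
      ∀ X : FI, Function.Surjective (V.cover x X) := by
  obtain ⟨s, hs, hgen⟩ := hV
  have := hs.to_subtype
  obtain ⟨k, ⟨e⟩⟩ := Finite.exists_equiv_fin s
  refine ⟨k, fun i => (e.symm i).1.1, fun i => (e.symm i).1.2, fun X =>
    LinearMap.range_eq_top.1 (hgen (V.coverRange _) (fun y hy => ?_) X)⟩
  obtain ⟨i, hi⟩ := e.symm.surjective ⟨y, hy⟩
  obtain rfl : (e.symm i).1 = y := congrArg Subtype.val hi
  exact V.mem_coverRange (fun i => (e.symm i).1.2) i

/-- The relations between the elements `x i`, as a sub-OI-module of the free FI-module on them. -/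
noncomputable def relations : OISub R m where
  obj n := LinearMap.ker (V.cover x (FI.std n))
  map_le {a b} f := by
    rintro _ ⟨p, hp, rfl⟩
    refine (V.cover_linearMap x (X := FI.std a) (Y := FI.std b) f.toEmbedding p).trans ?_
    rw [LinearMap.mem_ker.1 hp, map_zero]

variable {N n : ℕ}

variable (n) in
/-- The lift of `cover` along the natural map from the colimit to `V_n`. -/
noncomputable def colimitCover (hm : ∀ i, m i ≤ N) :
    (FreeBasis m (Fin n) →₀ R) →ₗ[R] V.smallColimit n N :=
  Finsupp.linearCombination R fun b =>
    V.toColimitOfHom (FreeBasis.hom (X := FI.std n) b)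
      ((Nat.card_fin _).trans_le (hm b.index)) (x b.index)

theorem fromColimit_colimitCover (hm : ∀ i, m i ≤ N) (p : FreeBasis m (Fin n) →₀ R) :
    V.fromColimit n N (V.colimitCover x n hm p) = V.cover x (FI.std n) p := by
  suffices h : (V.fromColimit n N).hom ∘ₗ V.colimitCover x n hm = V.cover x (FI.std n) from
    LinearMap.congr_fun h p
  refine Finsupp.lhom_ext fun b r => ?_
  simp only [LinearMap.comp_apply, colimitCover, Finsupp.linearCombination_single, map_smul]
  refine Eq.trans ?_ (V.cover_single x (X := FI.std n) b r).symm
  exact congrArg (r • ·) (ConcreteCategory.congr_hom (V.toColimitOfHom_comp_fromColimit _ _) _)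

theorem colimitCover_linearMap (hm : ∀ i, m i ≤ N) {X : FI} (f : X ⟶ FI.std n)
    (hX : Nat.card X.carrier ≤ N) (p : FreeBasis m X.carrier →₀ R) :
    V.colimitCover x n hm (FreeBasis.linearMap R f p) =
      V.toColimitOfHom f hX (V.cover x X p) := by
  suffices h : V.colimitCover x n hm ∘ₗ FreeBasis.linearMap R f =
      (V.toColimitOfHom f hX).hom ∘ₗ V.cover x X from LinearMap.congr_fun h p
  refine Finsupp.lhom_ext fun b r => ?_
  simp only [LinearMap.comp_apply, Finsupp.lmapDomain_apply, Finsupp.mapDomain_single,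
    colimitCover, Finsupp.linearCombination_single, cover_single, map_smul]
  exact congrArg (r • ·)
    (ConcreteCategory.congr_hom (V.map_comp_toColimitOfHom b.hom f _ hX) _).symm

variable {x}

theorem colimitCover_surjective (hm : ∀ i, m i ≤ N)
    (hx : ∀ X : FI, Function.Surjective (V.cover x X)) :
    Function.Surjective (V.colimitCover x n hm) := by
  refine LinearMap.range_eq_top.1 (V.smallColimit_submodule_eq_top fun S y => ?_)
  obtain ⟨p, rfl⟩ := hx _ y
  have hS : Nat.card (FI.ofFinset S.1).carrier ≤ N :=
    (Nat.card_eq_fintype_card.trans (Fintype.card_coe S.1)).trans_le S.2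
  exact ⟨_, (V.colimitCover_linearMap x hm (FI.incl S.1) hS p).trans
    (by rw [V.toColimitOfHom_incl S hS])⟩

theorem generatedLE_relations_le_ker_colimitCover (hm : ∀ i, m i ≤ N) :
    (V.relations x).generatedLE N n ≤ LinearMap.ker (V.colimitCover x n hm) := by
  refine iSup_le fun k => iSup_le fun hk => iSup_le fun f => ?_
  rintro _ ⟨p, hp, rfl⟩
  refine (V.colimitCover_linearMap x hm (X := FI.std k) f.toEmbedding
    ((Nat.card_fin k).trans_le hk) p).trans ?_
  rw [LinearMap.mem_ker.1 hp, map_zero]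

theorem fromColimit_bijective_of_presentation (hm : ∀ i, m i ≤ N)
    (hx : ∀ X : FI, Function.Surjective (V.cover x X))
    (hrel : (V.relations x).obj n ≤ (V.relations x).generatedLE N n) :
    Function.Bijective (V.fromColimit n N) := by
  constructor
  · refine (injective_iff_map_eq_zero (V.fromColimit n N).hom).2 fun z hz => ?_
    obtain ⟨p, rfl⟩ := V.colimitCover_surjective hm hx z
    have hp : p ∈ (V.relations x).obj n := (V.fromColimit_colimitCover x hm p).symm.trans hz
    exact V.generatedLE_relations_le_ker_colimitCover hm (hrel hp)
  · intro y
    obtain ⟨p, rfl⟩ := hx (FI.std n) y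
    exact ⟨_, V.fromColimit_colimitCover x hm p⟩

end Cover

end FIModule

theorem theorem6p2 {R : Type u} [Ring R] [IsNoetherianRing R] (V : FIModule.{u, v} R)
    (hV : V.FinitelyGenerated) :
    ∃ N : ℕ, ∀ n : ℕ, ∃ e : V.smallColimit n N ≃ₗ[R] V.obj (FI.std n),
      (∀ (S : SmallSubset n N) (x : V.obj (FI.ofFinset S.1)),
        e (V.toColimit S x) = V.map (FI.incl S.1) x) ∧
      ∀ (σ : Equiv.Perm (Fin n)) (x : V.smallColimit n N),
        e (V.permColimit n N σ x) = V.perm n σ (e x) := by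
  obtain ⟨k, m, x, hx⟩ := hV.exists_cover_surjective
  obtain ⟨N₀, hN₀⟩ := (V.relations x).exists_generatedLE_eq
  let N := max N₀ (Finset.univ.sup m)
  have hm (i : Fin k) : m i ≤ N := (Finset.le_sup (Finset.mem_univ i)).trans (le_max_right _ _)
  have hrel (n : ℕ) : (V.relations x).obj n ≤ (V.relations x).generatedLE N n :=
    (hN₀ n).symm.trans_le ((V.relations x).generatedLE_mono (le_max_left _ _) n)
  exact ⟨N, fun n => ⟨LinearEquiv.ofBijective (V.fromColimit n N).hom
      (V.fromColimit_bijective_of_presentation hm hx (hrel n)),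
    V.fromColimit_toColimit, V.fromColimit_permColimit⟩⟩
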